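/- Let $\mathcal H_A=\mathcal H_B=\mathbb C^2$. Let $\mathrm{SES}$ be the cone of positive semidefinite matrices on $\mathcal H_A\otimes\mathcal H_B$, let $\mathrm{SEP}$ be the cone of finite sums $\sum_i a_i\otimes b_i$ with $a_i$ and $b_i$ positive semidefinite matrices on $\mathcal H_A$ and $\mathcal H_B$, and let $\mathrm{SEP}^\ast$ be the set of Hermitian matrices $X$ on $\mathcal H_A\otimes\mathcal H_B$ with $\operatorname{Tr}XY\ge 0$ for all $Y\in\mathrm{SEP}$. For a cone $\mathcal C$ of Hermitian matrices put $\mathcal S(\mathcal C)=\{\rho\in\mathcal C : \operatorname{Tr}\rho=1\}$; a state $\rho\in\mathcal S(\mathcal C)$ is called pure if it is an extreme point of $\mathcal S(\mathcal C)$. A beyond-quantum state is an element of $\mathcal S(\mathrm{SEP}^\ast)\setminus\mathcal S(\mathrm{SES})$. For a Hermitian matrix $\rho$ on $\mathcal H_A\otimes\mathcal H_B$ and unitary $2\times2$ matrices $U_A,U_B$ let $$\mathbb A_{\mathrm{Pauli}}(\rho;U_A,U_B)=\sum_{c=x,y,z}\operatorname{Tr}\,(U_A\otimes U_B)\,\rho\,(U_A^\dagger\otimes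 U_B^\dagger)\,(\sigma_c\otimes\sigma_c),$$ where $\sigma_x=\begin{pmatrix}0&1\\1&0\end{pmatrix}$, $\sigma_y=\begin{pmatrix}0&-i\\i&0\end{pmatrix}$, $\sigma_z=\begin{pmatrix}1&0\\0&-1\end{pmatrix}$. Then: 1. For every beyond-quantum state $\rho_0$ that is a pure state of $\mathcal S(\mathrm{SEP}^\ast)$ there exist unitary matrices $U_A,U_B$ such that $\mathbb A_{\mathrm{Pauli}}(\rho_0;U_A,U_B)>1$. 2. $\mathbb A_{\mathrm{Pauli}}(\rho_1;U_A,U_B)\le 1$ for every $\rho_1\in\mathcal S(\mathrm{SES})$ and all unitary matrices $U_A,U_B$; that is, the supremum of these values is at most $1$. -/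

import Mathlib

open scoped Kronecker Matrix ComplexOrder

/-- The cone `L_H^+` of positive semidefinite complex matrices. -/
def psdCone (n : Type*) [Fintype n] : Set (Matrix n n ℂ) :=
  {X | X.PosSemidef}

/-- The separable cone `SEP(A;B) = L_H^+(H_A) ⊗ L_H^+(H_B)`: all finite sums of Kronecker
products `a ⊗ b` of positive semidefinite matrices. -/
def SEP (m n : Type*) [Fintype m] [Fintype n] : Set (Matrix (m × n) (m × n) ℂ) :=
  {X | ∃ (k : ℕ) (a : Fin k → Matrix m m ℂ) (b : Fin k → Matrix n n ℂ),
    (∀ i, a i ∈ psdCone m) ∧ (∀ i, b i ∈ psdCone n) ∧ X = ∑ i, a i ⊗ₖ b i}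

/-- The dual of a cone `C` in the real space of Hermitian matrices with inner product
`⟨X, Y⟩ = Tr (X Y)` (a real number when `X` and `Y` are Hermitian). -/
def dualCone {n : Type*} [Fintype n] (C : Set (Matrix n n ℂ)) : Set (Matrix n n ℂ) :=
  {X | X.IsHermitian ∧ ∀ Y ∈ C, 0 ≤ (X * Y).trace.re}

/-- The standard entanglement structure `SES(A;B) = L_H^+(H_A ⊗ H_B)`. -/
def SES (m n : Type*) [Fintype m] [Fintype n] : Set (Matrix (m × n) (m × n) ℂ) :=
  psdCone (m × n)

/-- The state space of the model with cone `C` and order unit `I`. -/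
def stateSpace {n : Type*} [Fintype n] (C : Set (Matrix n n ℂ)) : Set (Matrix n n ℂ) :=
  {ρ | ρ ∈ C ∧ ρ.trace = 1}

/-- A beyond-quantum state: a state of `SEP*(A;B)` that is not a state of `SES(A;B)`. -/
def IsBeyondQuantum {m n : Type*} [Fintype m] [Fintype n]
    (ρ : Matrix (m × n) (m × n) ℂ) : Prop :=
  ρ ∈ stateSpace (dualCone (SEP m n)) \ stateSpace (SES m n)

/-- A pure state of the model with cone `C`: an extreme point of its state space. -/
def IsPureState {n : Type*} [Fintype n] (C : Set (Matrix n n ℂ)) (ρ : Matrix n n ℂ) : Prop :=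
  ρ ∈ (stateSpace C).extremePoints ℝ

/-- The Pauli matrices `σ_x, σ_y, σ_z`, indexed by `0, 1, 2`. -/
def pauli : Fin 3 → Matrix (Fin 2) (Fin 2) ℂ :=
  ![!![0, 1; 1, 0], !![0, -Complex.I; Complex.I, 0], !![1, 0; 0, -1]]

/-- `A_Pauli(ρ; U_A, U_B) = ∑_c Tr (U_A ⊗ U_B) ρ (U_A† ⊗ U_B†) (σ_c ⊗ σ_c)`, as a real number.
The trace is real for every Hermitian `ρ`, see `ofReal_APauli`. -/
noncomputable def APauli (ρ : Matrix (Fin 2 × Fin 2) (Fin 2 × Fin 2) ℂ)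
    (UA UB : Matrix (Fin 2) (Fin 2) ℂ) : ℝ :=
  (∑ c, ((UA ⊗ₖ UB) * ρ * (UAᴴ ⊗ₖ UBᴴ) * (pauli c ⊗ₖ pauli c)).trace).re

theorem pauli_isHermitian (c : Fin 3) : (pauli c).IsHermitian := by
  ext i j
  fin_cases c <;> fin_cases i <;> fin_cases j <;> simp [pauli]

/-- For Hermitian `ρ` the complex trace expression is the real number `APauli ρ UA UB`. -/
theorem ofReal_APauli {ρ : Matrix (Fin 2 × Fin 2) (Fin 2 × Fin 2) ℂ} (hρ : ρ.IsHermitian)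
    (UA UB : Matrix (Fin 2) (Fin 2) ℂ) :
    (APauli ρ UA UB : ℂ) =
      ∑ c, ((UA ⊗ₖ UB) * ρ * (UAᴴ ⊗ₖ UBᴴ) * (pauli c ⊗ₖ pauli c)).trace := by
  unfold APauli
  refine Complex.conj_eq_iff_re.mp ?_
  rw [map_sum]
  refine Finset.sum_congr rfl fun c _ => ?_
  rw [starRingEnd_apply, ← Matrix.trace_conjTranspose, Matrix.conjTranspose_mul,
    Matrix.conjTranspose_mul, Matrix.conjTranspose_mul, hρ.eq, Matrix.conjTranspose_kronecker,
    Matrix.conjTranspose_kronecker, Matrix.conjTranspose_kronecker, (pauli_isHermitian c).eq,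
    Matrix.conjTranspose_conjTranspose, Matrix.conjTranspose_conjTranspose, Matrix.trace_mul_comm]
  simp only [Matrix.mul_assoc]

/-!
On two qubits every element of `SEP*` is decomposable, that is, of the form `P + Γ(Q)` with `P` and
`Q` positive semidefinite and `Γ` the partial transpose. To see this, subtract the largest multiple
of the identity that leaves `W` in `SEP*`; then `W` vanishes on some product vector, which local
changes of basis move to `|00⟩`, and further local shears kill all entries off the diagonal and the
antidiagonal. What remains splits by hand.

Since `P` and `Q` are sums of rank one operators, a pure state of `SEP*` that is not positive
semidefinite is proportional to `Γ(|ψ⟩⟨ψ|)`, where `ψ` is the vectorization of a matrix `M` with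
`det M ≠ 0`. On the other hand `∑ σ_c ⊗ σ_c = 1 - 2 |s⟩⟨s|` with `s = |01⟩ - |10⟩`, so
`A_Pauli(ρ; U, V)` exceeds `Tr ρ` exactly when the rotated singlet has negative expectation in `ρ`.
This is impossible if `ρ` is positive semidefinite. For `Γ(|ψ⟩⟨ψ|)` it is achieved by a unitary `U`
that makes `M U` positive definite, where the expectation is a multiple of `-det (M U)`.
-/

section Expectation

open Matrix

variable {m n : Type*} [Fintype n]

/-- The expectation value `⟨x| X |x⟩` of an observable `X`. Only the real part is recorded, so that
values can be compared; for Hermitian `X` nothing is lost. -/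
def expectation (X : Matrix n n ℂ) (x : n → ℂ) : ℝ := (star x ⬝ᵥ X *ᵥ x).re

theorem expectation_sub (X Y : Matrix n n ℂ) (x : n → ℂ) :
    expectation (X - Y) x = expectation X x - expectation Y x := by
  simp [expectation, sub_mulVec]

theorem expectation_smul (c : ℝ) (X : Matrix n n ℂ) (x : n → ℂ) :
    expectation (c • X) x = c * expectation X x := by
  simp [expectation, smul_mulVec]

theorem expectation_smul_vec (X : Matrix n n ℂ) (c : ℂ) (x : n → ℂ) :
    expectation X (c • x) = ‖c‖ ^ 2 * expectation X x := by
  rw [expectation, star_smul, mulVec_smul, smul_dotProduct, dotProduct_smul, smul_smul, smul_eq_mul,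
    Complex.star_def, Complex.conj_mul', ← Complex.ofReal_pow, Complex.re_ofReal_mul, expectation]

theorem expectation_conjTranspose_mul_mul [Fintype m] (X : Matrix m m ℂ) (A : Matrix m n ℂ)
    (x : n → ℂ) : expectation (Aᴴ * X * A) x = expectation X (A *ᵥ x) := by
  rw [expectation, expectation, star_mulVec, ← dotProduct_mulVec, mulVec_mulVec, mulVec_mulVec,
    Matrix.mul_assoc]

theorem expectation_single [DecidableEq n] (X : Matrix n n ℂ) (i : n) :
    expectation X (Pi.single i 1) = (X i i).re := by
  simp [expectation]

theorem expectation_submatrix [Fintype m] (X : Matrix n n ℂ) (e : m ≃ n) (x : m → ℂ) :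
    expectation (X.submatrix e e) x = expectation X (x ∘ e.symm) := by
  rw [expectation, expectation, submatrix_mulVec_equiv, ← comp_equiv_symm_dotProduct]
  rfl

theorem re_trace_mul_vecMulVec_star (X : Matrix n n ℂ) (x : n → ℂ) :
    (X * vecMulVec x (star x)).trace.re = expectation X x := by
  rw [mul_vecMulVec, trace_vecMulVec, dotProduct_comm, expectation]

theorem posSemidef_iff_expectation_nonneg {X : Matrix n n ℂ} :
    X.PosSemidef ↔ X.IsHermitian ∧ ∀ x, 0 ≤ expectation X x := by
  refine ⟨fun h => ⟨h.1, fun x => (Complex.nonneg_iff.mp (h.dotProduct_mulVec_nonneg x)).1⟩,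
    fun h => .of_dotProduct_mulVec_nonneg h.1 fun x => Complex.nonneg_iff.mpr ⟨h.2 x, ?_⟩⟩
  exact (h.1.im_star_dotProduct_mulVec_self x).symm

end Expectation

section TensorProduct

open Matrix

variable {m n m' n' : Type*}

/-- The product vector `a ⊗ b` of a bipartite system. -/
def tensorVec (a : m → ℂ) (b : n → ℂ) : m × n → ℂ := fun p => a p.1 * b p.2

theorem tensorVec_single [DecidableEq m] [DecidableEq n] (p : m × n) :
    tensorVec (Pi.single p.1 1) (Pi.single p.2 1) = Pi.single p 1 := by
  ext q
  simp only [tensorVec, Pi.single_apply, Prod.ext_iff, ite_and, mul_ite, mul_one, mul_zero]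
  grind

theorem tensorVec_smul_smul (s t : ℂ) (a : m → ℂ) (b : n → ℂ) :
    tensorVec (s • a) (t • b) = (s * t) • tensorVec a b := by
  ext p
  simp only [tensorVec, Pi.smul_apply, smul_eq_mul]
  ring

theorem tensorVec_comp_prodComm (a : m → ℂ) (b : n → ℂ) :
    tensorVec b a ∘ (Equiv.prodComm n m).symm = tensorVec a b :=
  funext fun _ => mul_comm _ _

theorem vecMulVec_star_kronecker (a : m → ℂ) (b : n → ℂ) :
    vecMulVec a (star a) ⊗ₖ vecMulVec b (star b) =
      vecMulVec (tensorVec a b) (star (tensorVec a b)) := by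
  ext p q
  simp only [kroneckerMap_apply, vecMulVec_apply, tensorVec, Pi.star_apply, star_mul']
  ring

variable [Fintype m] [Fintype n]

theorem kronecker_mulVec_tensorVec (A : Matrix m' m ℂ) (B : Matrix n' n ℂ)
    (a : m → ℂ) (b : n → ℂ) :
    (A ⊗ₖ B) *ᵥ tensorVec a b = tensorVec (A *ᵥ a) (B *ᵥ b) := by
  ext p
  simp only [mulVec, dotProduct, tensorVec, kroneckerMap_apply, Fintype.sum_prod_type,
    Finset.sum_mul_sum]
  exact Finset.sum_congr rfl fun i _ => Finset.sum_congr rfl fun j _ => by ring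

theorem kronecker_mem_SEP {A : Matrix m m ℂ} {B : Matrix n n ℂ} (hA : A.PosSemidef)
    (hB : B.PosSemidef) : A ⊗ₖ B ∈ SEP m n :=
  ⟨1, fun _ => A, fun _ => B, fun _ => hA, fun _ => hB, by simp⟩

theorem re_trace_mul_conjTranspose_mul_self [DecidableEq n] (X A : Matrix n n ℂ) :
    (X * (Aᴴ * A)).trace.re = ∑ i, expectation X (Aᴴ *ᵥ Pi.single i 1) := by
  simp only [← expectation_conjTranspose_mul_mul, conjTranspose_conjTranspose, expectation_single]
  rw [← Matrix.mul_assoc, trace_mul_comm, ← Matrix.mul_assoc, trace, Complex.re_sum]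
  rfl

open scoped MatrixOrder Matrix.Norms.L2Operator in
theorem mem_dualCone_SEP_iff {X : Matrix (m × n) (m × n) ℂ} :
    X ∈ dualCone (SEP m n) ↔ X.IsHermitian ∧ ∀ a b, 0 ≤ expectation X (tensorVec a b) := by
  classical
  refine and_congr_right fun _ => ⟨fun h a b => ?_, fun h => ?_⟩
  · rw [← re_trace_mul_vecMulVec_star, ← vecMulVec_star_kronecker]
    exact h _ (kronecker_mem_SEP (posSemidef_vecMulVec_self_star a)
      (posSemidef_vecMulVec_self_star b))
  · rintro _ ⟨k, A, B, hA, hB, rfl⟩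
    rw [Finset.mul_sum, trace_sum, Complex.re_sum]
    refine Finset.sum_nonneg fun i _ => ?_
    obtain ⟨C, hC⟩ := CStarAlgebra.nonneg_iff_eq_star_mul_self.mp (hA i).nonneg
    obtain ⟨D, hD⟩ := CStarAlgebra.nonneg_iff_eq_star_mul_self.mp (hB i).nonneg
    rw [hC, hD, star_eq_conjTranspose, star_eq_conjTranspose, mul_kronecker_mul,
      ← conjTranspose_kronecker, re_trace_mul_conjTranspose_mul_self]
    refine Finset.sum_nonneg fun p _ => ?_
    rw [conjTranspose_kronecker, ← tensorVec_single, kronecker_mulVec_tensorVec]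
    exact h _ _

theorem apply_self_nonneg_of_mem_dualCone_SEP {X : Matrix (m × n) (m × n) ℂ}
    (hX : X ∈ dualCone (SEP m n)) (p : m × n) : 0 ≤ X p p := by
  classical
  have h := (mem_dualCone_SEP_iff.mp hX).2 (Pi.single p.1 1) (Pi.single p.2 1)
  rw [tensorVec_single, expectation_single] at h
  exact (Complex.zero_le_real.mpr h).trans_eq (hX.1.coe_re_apply_self p)

theorem posSemidef_mem_dualCone_SEP {X : Matrix (m × n) (m × n) ℂ} (hX : X.PosSemidef) :
    X ∈ dualCone (SEP m n) :=
  mem_dualCone_SEP_iff.mpr ⟨hX.1, fun _ _ => (posSemidef_iff_expectation_nonneg.mp hX).2 _⟩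

theorem conjTranspose_mul_mul_kronecker_mem_dualCone_SEP [Fintype m'] [Fintype n']
    {X : Matrix (m × n) (m × n) ℂ} (hX : X ∈ dualCone (SEP m n)) (A : Matrix m m' ℂ)
    (B : Matrix n n' ℂ) : (A ⊗ₖ B)ᴴ * X * (A ⊗ₖ B) ∈ dualCone (SEP m' n') := by
  rw [mem_dualCone_SEP_iff] at hX ⊢
  refine ⟨isHermitian_conjTranspose_mul_mul _ hX.1, fun a b => ?_⟩
  rw [expectation_conjTranspose_mul_mul, kronecker_mulVec_tensorVec]
  exact hX.2 _ _

theorem submatrix_swap_mem_dualCone_SEP {X : Matrix (m × n) (m × n) ℂ}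
    (hX : X ∈ dualCone (SEP m n)) : X.submatrix Prod.swap Prod.swap ∈ dualCone (SEP n m) := by
  rw [mem_dualCone_SEP_iff] at hX ⊢
  refine ⟨hX.1.submatrix _, fun b a => ?_⟩
  have h := expectation_submatrix X (Equiv.prodComm n m) (tensorVec b a)
  rw [tensorVec_comp_prodComm] at h
  exact (hX.2 a b).trans_eq h.symm

end TensorProduct

section PosSemidef

open Matrix

variable {n : Type*}

theorem norm_apply_sq_le_of_posSemidef {A : Matrix n n ℂ}
    (hA : A.PosSemidef) (i j : n) : ‖A i j‖ ^ 2 ≤ (A i i).re * (A j j).re := by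
  have hdet := (Complex.nonneg_iff.mp (hA.submatrix ![i, j]).det_nonneg).1
  have hnorm : A i j * A j i = ((‖A i j‖ ^ 2 : ℝ) : ℂ) := by
    rw [← hA.1.apply j i, Complex.star_def, Complex.mul_conj', Complex.ofReal_pow]
  have hdiag : A i i * A j j = (((A i i).re * (A j j).re : ℝ) : ℂ) := by
    rw [Complex.ofReal_mul]
    exact congrArg₂ _ (hA.1.coe_re_apply_self i).symm (hA.1.coe_re_apply_self j).symm
  rw [det_fin_two] at hdet
  simp only [submatrix_apply, cons_val_zero, cons_val_one] at hdet
  rw [hnorm, hdiag, ← Complex.ofReal_sub, Complex.ofReal_re] at hdet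
  exact sub_nonneg.mp hdet

theorem posSemidef_apply_eq_zero {A : Matrix n n ℂ} (hA : A.PosSemidef) {i : n}
    (h : A i i = 0) (j : n) : A j i = 0 := by
  have hle := norm_apply_sq_le_of_posSemidef hA j i
  rw [h, Complex.zero_re, mul_zero] at hle
  exact norm_eq_zero.mp (pow_eq_zero_iff two_ne_zero |>.mp (hle.antisymm (sq_nonneg _)))

end PosSemidef

section Slice

open Matrix

variable {m n : Type*} [Fintype m]

/-- The partial matrix element `⟨a| X |a⟩` of a bipartite operator in the first factor, an operator
on the second factor. -/
def leftSlice (X : Matrix (m × n) (m × n) ℂ) (a : m → ℂ) : Matrix n n ℂ :=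
  of fun j l => ∑ i, ∑ k, star (a i) * X (i, j) (k, l) * a k

theorem leftSlice_single [DecidableEq m] (X : Matrix (m × n) (m × n) ℂ) (i : m) (j l : n) :
    leftSlice X (Pi.single i 1) j l = X (i, j) (i, l) := by
  simp [leftSlice, Pi.single_apply, apply_ite]

variable [Fintype n]

theorem expectation_leftSlice (X : Matrix (m × n) (m × n) ℂ) (a : m → ℂ) (b : n → ℂ) :
    expectation (leftSlice X a) b = expectation X (tensorVec a b) := by
  simp only [expectation, dotProduct, mulVec, leftSlice, tensorVec, of_apply, Pi.star_apply,
    star_mul', Fintype.sum_prod_type, Finset.mul_sum, Finset.sum_mul]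
  congr 1
  conv_rhs => rw [Finset.sum_comm]
  refine Finset.sum_congr rfl fun j _ => ?_
  rw [Finset.sum_comm]
  refine Finset.sum_congr rfl fun i _ => ?_
  rw [Finset.sum_comm]
  exact Finset.sum_congr rfl fun k _ => Finset.sum_congr rfl fun l _ => by ring

theorem leftSlice_posSemidef {X : Matrix (m × n) (m × n) ℂ} (hX : X ∈ dualCone (SEP m n))
    (a : m → ℂ) : (leftSlice X a).PosSemidef := by
  rw [mem_dualCone_SEP_iff] at hX
  refine posSemidef_iff_expectation_nonneg.mpr ⟨?_, fun b => ?_⟩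
  · ext j l
    simp only [leftSlice, conjTranspose_apply, of_apply, star_sum, star_mul', star_star]
    rw [Finset.sum_comm]
    refine Finset.sum_congr rfl fun k _ => Finset.sum_congr rfl fun i _ => ?_
    rw [hX.1.apply]
    ring
  · rw [expectation_leftSlice]
    exact hX.2 a b

end Slice

section PartialTranspose

open Matrix

variable {m n : Type*}

/-- The partial transpose on the second tensor factor. -/
def partialTranspose (X : Matrix (m × n) (m × n) ℂ) : Matrix (m × n) (m × n) ℂ :=
  of fun p q => X (p.1, q.2) (q.1, p.2)

theorem partialTranspose_apply (X : Matrix (m × n) (m × n) ℂ) (p q : m × n) :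
    partialTranspose X p q = X (p.1, q.2) (q.1, p.2) := rfl

theorem partialTranspose_sum {ι : Type*} (s : Finset ι) (X : ι → Matrix (m × n) (m × n) ℂ) :
    partialTranspose (∑ i ∈ s, X i) = ∑ i ∈ s, partialTranspose (X i) := by
  ext p q
  simp only [partialTranspose_apply, Matrix.sum_apply]

theorem isHermitian_partialTranspose {X : Matrix (m × n) (m × n) ℂ} (hX : X.IsHermitian) :
    (partialTranspose X).IsHermitian := by
  ext p q
  exact hX.apply _ _

/-- A bipartite operator is decomposable if it is the sum of a positive semidefinite matrix and of
the partial transpose of one. -/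
def IsDecomposable (W : Matrix (m × n) (m × n) ℂ) : Prop :=
  ∃ P Q : Matrix (m × n) (m × n) ℂ, P.PosSemidef ∧ Q.PosSemidef ∧ W = P + partialTranspose Q

theorem isDecomposable_of_posSemidef {W : Matrix (m × n) (m × n) ℂ} (hW : W.PosSemidef) :
    IsDecomposable W :=
  ⟨W, 0, hW, .zero, (add_zero W).symm⟩

theorem IsDecomposable.add_posSemidef {W P : Matrix (m × n) (m × n) ℂ} (hW : IsDecomposable W)
    (hP : P.PosSemidef) : IsDecomposable (W + P) := by
  obtain ⟨P', Q, hP', hQ, rfl⟩ := hW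
  exact ⟨P' + P, Q, hP'.add hP, hQ, add_right_comm _ _ _⟩

variable [Fintype m] [Fintype n]

theorem partialTranspose_conjTranspose_mul_mul (X : Matrix (m × n) (m × n) ℂ) (A : Matrix m m ℂ)
    (B : Matrix n n ℂ) :
    partialTranspose ((A ⊗ₖ B)ᴴ * X * (A ⊗ₖ B)) =
      (A ⊗ₖ B.map star)ᴴ * partialTranspose X * (A ⊗ₖ B.map star) := by
  ext ⟨i, j⟩ ⟨k, l⟩
  simp only [mul_apply, Fintype.sum_prod_type, Finset.sum_mul, partialTranspose_apply,
    kroneckerMap_apply, conjTranspose_apply, map_apply, star_mul', star_star]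
  refine Finset.sum_congr rfl fun a _ => ?_
  conv_lhs => rw [Finset.sum_comm]
  conv_rhs => rw [Finset.sum_comm]
  refine Finset.sum_congr rfl fun d _ => ?_
  rw [Finset.sum_comm]
  exact Finset.sum_congr rfl fun e _ => Finset.sum_congr rfl fun f _ => by ring

theorem expectation_partialTranspose_tensorVec (X : Matrix (m × n) (m × n) ℂ) (a : m → ℂ)
    (b : n → ℂ) :
    expectation (partialTranspose X) (tensorVec a b) = expectation X (tensorVec a (star b)) := by
  simp only [expectation, dotProduct, mulVec, tensorVec, partialTranspose_apply, Pi.star_apply,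
    star_mul', star_star, Fintype.sum_prod_type, Finset.mul_sum]
  congr 1
  refine Finset.sum_congr rfl fun i _ => ?_
  conv_lhs => rw [Finset.sum_comm]
  conv_rhs => rw [Finset.sum_comm]
  refine Finset.sum_congr rfl fun k _ => ?_
  rw [Finset.sum_comm]
  exact Finset.sum_congr rfl fun l _ => Finset.sum_congr rfl fun j _ => by ring

theorem partialTranspose_mem_dualCone_SEP {X : Matrix (m × n) (m × n) ℂ} (hX : X.PosSemidef) :
    partialTranspose X ∈ dualCone (SEP m n) := by
  refine mem_dualCone_SEP_iff.mpr ⟨isHermitian_partialTranspose hX.1, fun a b => ?_⟩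
  rw [expectation_partialTranspose_tensorVec]
  exact (posSemidef_iff_expectation_nonneg.mp hX).2 _

theorem IsDecomposable.conjTranspose_mul_mul_kronecker {W : Matrix (m × n) (m × n) ℂ}
    (hW : IsDecomposable W) (A : Matrix m m ℂ) (B : Matrix n n ℂ) :
    IsDecomposable ((A ⊗ₖ B)ᴴ * W * (A ⊗ₖ B)) := by
  obtain ⟨P, Q, hP, hQ, rfl⟩ := hW
  have hB : (B.map star).map star = B := by ext; simp
  refine ⟨_, _, hP.conjTranspose_mul_mul_same (A ⊗ₖ B),
    hQ.conjTranspose_mul_mul_same (A ⊗ₖ B.map star), ?_⟩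
  rw [partialTranspose_conjTranspose_mul_mul, hB, Matrix.mul_add, Matrix.add_mul]

theorem isDecomposable_of_conjTranspose_mul_mul_kronecker [DecidableEq m] [DecidableEq n]
    {W : Matrix (m × n) (m × n) ℂ} {A : Matrix m m ℂ} {B : Matrix n n ℂ} (hA : IsUnit A)
    (hB : IsUnit B) (hW : IsDecomposable ((A ⊗ₖ B)ᴴ * W * (A ⊗ₖ B))) : IsDecomposable W := by
  have hAB : (A ⊗ₖ B) * (A⁻¹ ⊗ₖ B⁻¹) = 1 := by
    rw [← mul_kronecker_mul, mul_nonsing_inv _ ((isUnit_iff_isUnit_det A).mp hA),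
      mul_nonsing_inv _ ((isUnit_iff_isUnit_det B).mp hB), one_kronecker_one]
  have h := hW.conjTranspose_mul_mul_kronecker A⁻¹ B⁻¹
  rwa [← Matrix.mul_assoc, ← Matrix.mul_assoc, ← conjTranspose_mul, hAB, conjTranspose_one,
    Matrix.one_mul, Matrix.mul_assoc, hAB, Matrix.mul_one] at h

end PartialTranspose

section PureState

variable {n : Type*} [Fintype n] {C : Set (Matrix n n ℂ)}

theorem add_mem_dualCone {X Y : Matrix n n ℂ} (hX : X ∈ dualCone C) (hY : Y ∈ dualCone C) :
    X + Y ∈ dualCone C := by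
  refine ⟨hX.1.add hY.1, fun Z hZ => ?_⟩
  rw [Matrix.add_mul, Matrix.trace_add, Complex.add_re]
  exact add_nonneg (hX.2 Z hZ) (hY.2 Z hZ)

theorem smul_mem_dualCone {X : Matrix n n ℂ} (hX : X ∈ dualCone C) {c : ℝ} (hc : 0 ≤ c) :
    c • X ∈ dualCone C := by
  refine ⟨hX.1.smul (.all c), fun Z hZ => ?_⟩
  rw [Matrix.smul_mul, Matrix.trace_smul, Complex.smul_re]
  exact mul_nonneg hc (hX.2 Z hZ)

theorem sum_mem_dualCone {ι : Type*} {s : Finset ι} {X : ι → Matrix n n ℂ}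
    (hX : ∀ i ∈ s, X i ∈ dualCone C) : ∑ i ∈ s, X i ∈ dualCone C :=
  Finset.sum_induction X _ (fun _ _ => add_mem_dualCone)
    ⟨Matrix.isHermitian_zero, fun _ _ => by simp⟩ hX

theorem trace_re_nonneg_of_mem_dualCone [DecidableEq n] (hC : 1 ∈ C) {X : Matrix n n ℂ}
    (hX : X ∈ dualCone C) : 0 ≤ X.trace.re := by
  simpa using hX.2 1 hC

theorem inv_trace_smul_mem_stateSpace {X : Matrix n n ℂ} (hX : X ∈ dualCone C)
    (ht : 0 < X.trace.re) : X.trace.re⁻¹ • X ∈ stateSpace (dualCone C) := by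
  refine ⟨smul_mem_dualCone hX (inv_nonneg.mpr ht.le), ?_⟩
  have htr : (X.trace.re : ℂ) = X.trace :=
    Complex.conj_eq_iff_re.mp ((Matrix.trace_conjTranspose X).symm.trans (congrArg _ hX.1))
  rw [Matrix.trace_smul, Complex.real_smul, Complex.ofReal_inv, htr, inv_mul_cancel₀]
  rw [← htr]
  exact Complex.ofReal_ne_zero.mpr ht.ne'

theorem IsPureState.eq_inv_trace_smul_of_eq_add [DecidableEq n] (hC : 1 ∈ C) {ρ X Y : Matrix n n ℂ}
    (hρ : IsPureState (dualCone C) ρ) (hX : X ∈ dualCone C) (hY : Y ∈ dualCone C)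
    (h : ρ = X + Y) (ht : 0 < X.trace.re) : ρ = X.trace.re⁻¹ • X := by
  -- Only half of `X` is split off, so that the complement has positive trace even if `Y = 0`.
  set Z := (1 / 2 : ℝ) • X + Y with hZ
  have hZC : Z ∈ dualCone C := add_mem_dualCone (smul_mem_dualCone hX (by norm_num)) hY
  have htZ : Z.trace.re = 1 / 2 * X.trace.re + Y.trace.re := by
    simp only [hZ, Matrix.trace_add, Matrix.trace_smul, Complex.add_re, Complex.smul_re,
      smul_eq_mul]
  have htr : X.trace.re + Y.trace.re = 1 := by
    rw [← Complex.add_re, ← Matrix.trace_add, ← h, hρ.1.2, Complex.one_re]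
  have htZ0 : 0 < Z.trace.re := by
    linarith [trace_re_nonneg_of_mem_dualCone hC hY]
  refine (hρ.2 (inv_trace_smul_mem_stateSpace hX ht) (inv_trace_smul_mem_stateSpace hZC htZ0)
    ⟨X.trace.re / 2, Z.trace.re, half_pos ht, htZ0, by linarith, ?_⟩).symm
  rw [smul_inv_smul₀ htZ0.ne', smul_smul, div_mul_eq_mul_div, mul_inv_cancel₀ ht.ne', hZ,
    ← add_assoc, ← add_smul, add_halves, one_smul, h]

theorem IsPureState.exists_eq_smul_of_eq_sum [DecidableEq n] (hC : 1 ∈ C) {ρ : Matrix n n ℂ}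
    (hρ : IsPureState (dualCone C) ρ) {ι : Type*} [Fintype ι] {X : ι → Matrix n n ℂ}
    (hX : ∀ i, X i ∈ dualCone C) (h : ρ = ∑ i, X i) : ∃ i, ∃ c : ℝ, 0 ≤ c ∧ ρ = c • X i := by
  classical
  have htr : ∑ i, (X i).trace.re = 1 := by
    rw [← Complex.re_sum, ← Matrix.trace_sum, ← h, hρ.1.2, Complex.one_re]
  obtain ⟨i, -, hi⟩ : ∃ i ∈ Finset.univ, 0 < (X i).trace.re :=
    Finset.exists_lt_of_sum_lt (by rw [htr, Finset.sum_const_zero]; exact one_pos)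
  refine ⟨i, _, inv_nonneg.mpr hi.le, hρ.eq_inv_trace_smul_of_eq_add hC (hX i)
    (sum_mem_dualCone (s := Finset.univ.erase i) fun j _ => hX j) ?_ hi⟩
  rw [h, Finset.add_sum_erase _ _ (Finset.mem_univ i)]

end PureState

section Minimum

open Matrix

variable {m n : Type*} [Fintype m] [Fintype n]

theorem mem_dualCone_SEP_of_forall_norm_eq_one {X : Matrix (m × n) (m × n) ℂ} (hX : X.IsHermitian)
    (h : ∀ (a : EuclideanSpace ℂ m) (b : EuclideanSpace ℂ n), ‖a‖ = 1 → ‖b‖ = 1 →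
      0 ≤ expectation X (tensorVec a b)) : X ∈ dualCone (SEP m n) := by
  have key : ∀ (a : EuclideanSpace ℂ m) (b : EuclideanSpace ℂ n),
      0 ≤ expectation X (tensorVec a b) := fun a b => by
    rcases eq_or_ne a 0 with rfl | ha
    · simp [tensorVec, expectation, dotProduct]
    rcases eq_or_ne b 0 with rfl | hb
    · simp [tensorVec, expectation, dotProduct]
    have hpos : 0 < ‖(‖a‖⁻¹ : ℂ) * (‖b‖⁻¹ : ℂ)‖ ^ 2 := by simp [ha, hb]
    have hab := h ((‖a‖⁻¹ : ℂ) • a) ((‖b‖⁻¹ : ℂ) • b) (norm_smul_inv_norm ha)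
      (norm_smul_inv_norm hb)
    rw [WithLp.ofLp_smul, WithLp.ofLp_smul, tensorVec_smul_smul, expectation_smul_vec] at hab
    exact (mul_nonneg_iff_of_pos_left hpos).mp hab
  exact mem_dualCone_SEP_iff.mpr ⟨hX, fun a b => key (WithLp.toLp 2 a) (WithLp.toLp 2 b)⟩

theorem expectation_one_tensorVec [DecidableEq m] [DecidableEq n] (a : EuclideanSpace ℂ m)
    (b : EuclideanSpace ℂ n) :
    expectation (1 : Matrix (m × n) (m × n) ℂ) (tensorVec a b) = ‖a‖ ^ 2 * ‖b‖ ^ 2 := by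
  rw [EuclideanSpace.norm_sq_eq, EuclideanSpace.norm_sq_eq, Finset.sum_mul_sum, expectation,
    one_mulVec, dotProduct, Complex.re_sum, Fintype.sum_prod_type]
  refine Finset.sum_congr rfl fun i _ => Finset.sum_congr rfl fun j _ => ?_
  rw [Pi.star_apply, Complex.star_def, Complex.conj_mul', tensorVec, norm_mul, ← mul_pow]
  norm_cast

theorem continuous_expectation_tensorVec (X : Matrix (m × n) (m × n) ℂ) :
    Continuous fun x : EuclideanSpace ℂ m × EuclideanSpace ℂ n =>
      expectation X (tensorVec x.1 x.2) := by
  unfold expectation tensorVec dotProduct mulVec dotProduct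
  simp only [Pi.star_apply]
  fun_prop

theorem exists_sub_smul_one_mem_dualCone_SEP [DecidableEq m] [DecidableEq n] [Nonempty m]
    [Nonempty n] {X : Matrix (m × n) (m × n) ℂ} (hX : X ∈ dualCone (SEP m n)) :
    ∃ μ : ℝ, 0 ≤ μ ∧ X - μ • 1 ∈ dualCone (SEP m n) ∧
      ∃ a b, a ≠ 0 ∧ b ≠ 0 ∧ expectation (X - μ • 1) (tensorVec a b) = 0 := by
  let S := Metric.sphere (0 : EuclideanSpace ℂ m) 1 ×ˢ Metric.sphere (0 : EuclideanSpace ℂ n) 1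
  have hS : IsCompact S := (isCompact_sphere _ _).prod (isCompact_sphere _ _)
  have hne : S.Nonempty :=
    (NormedSpace.sphere_nonempty.mpr zero_le_one).prod (NormedSpace.sphere_nonempty.mpr zero_le_one)
  obtain ⟨⟨a, b⟩, hab, hmin⟩ :=
    hS.exists_isMinOn hne (continuous_expectation_tensorVec X).continuousOn
  set μ := expectation X (tensorVec a b)
  have hsub : ∀ (x : EuclideanSpace ℂ m) (y : EuclideanSpace ℂ n), ‖x‖ = 1 → ‖y‖ = 1 →
      expectation (X - μ • 1) (tensorVec x y) = expectation X (tensorVec x y) - μ :=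
    fun x y hx hy => by
      rw [expectation_sub, expectation_smul, expectation_one_tensorVec, hx, hy, one_pow, mul_one,
        mul_one]
  have ha : ‖a‖ = 1 := mem_sphere_zero_iff_norm.mp hab.1
  have hb : ‖b‖ = 1 := mem_sphere_zero_iff_norm.mp hab.2
  refine ⟨μ, (mem_dualCone_SEP_iff.mp hX).2 a b, mem_dualCone_SEP_of_forall_norm_eq_one ?_ ?_,
    a, b, ?_, ?_, (hsub a b ha hb).trans (sub_self μ)⟩
  · exact hX.1.sub ((isHermitian_one (α := ℂ)).smul (.all μ))
  · intro x y hx hy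
    rw [hsub x y hx hy]
    exact sub_nonneg.mpr (isMinOn_iff.mp hmin (x, y)
      ⟨mem_sphere_zero_iff_norm.mpr hx, mem_sphere_zero_iff_norm.mpr hy⟩)
  · exact fun h => one_ne_zero (ha.symm.trans (norm_eq_zero.mpr (WithLp.ofLp_injective 2 h)))
  · exact fun h => one_ne_zero (hb.symm.trans (norm_eq_zero.mpr (WithLp.ofLp_injective 2 h)))

theorem exists_isUnit_mulVec_eq [DecidableEq n] {x y : n → ℂ} (hx : x ≠ 0)
    (hy : y ≠ 0) : ∃ A : Matrix n n ℂ, IsUnit A ∧ A *ᵥ x = y := by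
  obtain ⟨f, hf⟩ := SeparatingDual.exists_continuousLinearEquiv_apply_eq (R := ℂ) hx hy
  let g : (n → ℂ) ≃ₗ[ℂ] (n → ℂ) := f.toLinearEquiv
  refine ⟨LinearMap.toMatrix' g.toLinearMap, ?_, ?_⟩
  · rw [isUnit_iff_isUnit_det, LinearMap.det_toMatrix']
    exact g.isUnit_det'
  · rw [← Matrix.toLin'_apply, Matrix.toLin'_toMatrix']
    exact hf

end Minimum

section LeastSquares

open scoped InnerProductSpace

theorem eq_zero_of_forall_mul_le {s k : ℝ} (h : ∀ t : ℝ, t * s ≤ k) : s = 0 := by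
  by_contra hs
  have := h ((k + 1) / s)
  rw [div_mul_cancel₀ _ hs] at this
  linarith

theorem nonpos_of_forall_sq_mul_le {s k : ℝ} (h : ∀ t : ℝ, t ^ 2 * s ≤ k) : s ≤ 0 := by
  by_contra! hs
  have hk : 0 ≤ k := by simpa using h 0
  have := h (k / s + 1)
  have hks : k / s * s = k := div_mul_cancel₀ _ hs.ne'
  nlinarith [sq_nonneg (k / s), div_nonneg hk hs.le]

variable {E F : Type*} [NormedAddCommGroup E] [InnerProductSpace ℝ E] [NormedAddCommGroup F]
  [InnerProductSpace ℝ F]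

theorem norm_map_add_sq_smul (L : E →ₗ[ℝ] F) (g : F) (t : ℝ) (x : E) :
    ‖L (t • x) + g‖ ^ 2 = t ^ 2 * ‖L x‖ ^ 2 + 2 * t * ⟪L x, g⟫_ℝ + ‖g‖ ^ 2 := by
  rw [map_smul, norm_add_sq_real, norm_smul, real_inner_smul_left, mul_pow, Real.norm_eq_abs,
    sq_abs]
  ring

theorem norm_map_sq_le_of_forall_norm_map_add_sq_le (L : E →ₗ[ℝ] F) {g : F} {h : E} {a k : ℝ}
    (H : ∀ x, ‖L x + g‖ ^ 2 ≤ a * ‖x‖ ^ 2 + 2 * ⟪h, x⟫_ℝ + k) (x : E) :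
    ‖L x‖ ^ 2 ≤ a * ‖x‖ ^ 2 := by
  refine sub_nonpos.mp (nonpos_of_forall_sq_mul_le (k := k - ‖g‖ ^ 2) fun t => ?_)
  have h₁ := H (t • x)
  have h₂ := H ((-t) • x)
  rw [norm_map_add_sq_smul, norm_smul, mul_pow, Real.norm_eq_abs, sq_abs, real_inner_smul_right]
    at h₁ h₂
  linarith

-- The critical point equation of the quadratic function `a‖x‖² + 2⟪h, x⟫ + k - ‖L x + g‖²`. It is
-- solvable because boundedness below makes the linear part orthogonal to the kernel of the
-- quadratic part.
theorem exists_adjoint_map_add_eq_of_forall_norm_map_add_sq_le [FiniteDimensional ℝ E]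
    [FiniteDimensional ℝ F] (L : E →ₗ[ℝ] F) {g : F} {h : E} {a k : ℝ}
    (H : ∀ x, ‖L x + g‖ ^ 2 ≤ a * ‖x‖ ^ 2 + 2 * ⟪h, x⟫_ℝ + k) :
    ∃ x, L.adjoint (L x + g) = a • x + h := by
  let T : E →ₗ[ℝ] E := a • LinearMap.id - L.adjoint ∘ₗ L
  have hT : T.IsSymmetric := fun x y => by
    simp only [T, LinearMap.sub_apply, LinearMap.smul_apply, LinearMap.id_apply,
      LinearMap.comp_apply, inner_sub_left, inner_sub_right, real_inner_smul_left,
      real_inner_smul_right, LinearMap.adjoint_inner_left, LinearMap.adjoint_inner_right]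
  suffices L.adjoint g - h ∈ T.range by
    obtain ⟨x, hx⟩ := this
    refine ⟨x, ?_⟩
    rw [map_add, add_comm]
    exact (sub_eq_sub_iff_add_eq_add.mp hx).symm
  rw [← Submodule.orthogonal_orthogonal T.range, hT.orthogonal_range, Submodule.mem_orthogonal]
  intro v hv
  have hLv : L.adjoint (L v) = a • v := (sub_eq_zero.mp hv).symm
  have hnorm : ‖L v‖ ^ 2 = a * ‖v‖ ^ 2 := by
    rw [← real_inner_self_eq_norm_sq, ← LinearMap.adjoint_inner_right, hLv, real_inner_smul_right,
      real_inner_self_eq_norm_sq]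
  refine eq_zero_of_forall_mul_le (k := (k - ‖g‖ ^ 2) / 2) fun t => ?_
  have ht := H (t • v)
  rw [norm_map_add_sq_smul, norm_smul, mul_pow, Real.norm_eq_abs, sq_abs, real_inner_smul_right,
    hnorm] at ht
  rw [inner_sub_right, LinearMap.adjoint_inner_right, real_inner_comm h v]
  linarith

end LeastSquares

section ZeroDiagonal

open Matrix

variable {m n : Type*} [Fintype m] [Fintype n] {X : Matrix (m × n) (m × n) ℂ}

theorem eq_zero_of_forall_star_dotProduct_mulVec_eq_zero {A : Matrix n n ℂ}
    (h : ∀ x, star x ⬝ᵥ A *ᵥ x = 0) : A = 0 := by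
  classical
  refine (toEuclideanLin (𝕜 := ℂ)).map_eq_zero_iff.mp ((inner_map_self_eq_zero _).mp fun x => ?_)
  rw [← inner_conj_symm, EuclideanSpace.inner_eq_star_dotProduct, dotProduct_comm]
  simpa using h x

theorem apply_right_eq_zero_of_mem_dualCone_SEP (hX : X ∈ dualCone (SEP m n)) {i : m} {j : n}
    (h : X (i, j) (i, j) = 0) (l : n) : X (i, l) (i, j) = 0 := by
  classical
  simpa only [leftSlice_single] using posSemidef_apply_eq_zero
    (leftSlice_posSemidef hX (Pi.single i 1)) ((leftSlice_single X i j j).trans h) l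

theorem apply_left_eq_zero_of_mem_dualCone_SEP (hX : X ∈ dualCone (SEP m n)) {i : m} {j : n}
    (h : X (i, j) (i, j) = 0) (k : m) : X (k, j) (i, j) = 0 :=
  apply_right_eq_zero_of_mem_dualCone_SEP (submatrix_swap_mem_dualCone_SEP hX) (i := j) h k

theorem apply_eq_zero_of_mem_dualCone_SEP (hX : X ∈ dualCone (SEP m n)) {j : n}
    (h : ∀ i, X (i, j) (i, j) = 0) (i k : m) (l : n) : X (i, l) (k, j) = 0 := by
  suffices (of fun i k => X (i, l) (k, j)) = 0 from congrFun₂ this i k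
  refine eq_zero_of_forall_star_dotProduct_mulVec_eq_zero fun a => ?_
  have hjj : leftSlice X a j j = 0 :=
    Finset.sum_eq_zero fun i _ => Finset.sum_eq_zero fun k _ => by
      rw [apply_left_eq_zero_of_mem_dualCone_SEP hX (h k), mul_zero, zero_mul]
  rw [← posSemidef_apply_eq_zero (leftSlice_posSemidef hX a) hjj l]
  simp only [leftSlice, dotProduct, mulVec, of_apply, Pi.star_apply, Finset.mul_sum, mul_assoc]

theorem posSemidef_of_apply_eq_zero {X : Matrix (m × Fin 2) (m × Fin 2) ℂ}
    (hX : X ∈ dualCone (SEP m (Fin 2))) (h : ∀ i, X (i, 0) (i, 0) = 0) : X.PosSemidef := by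
  have hcol : ∀ i k l, X (i, l) (k, 0) = 0 := apply_eq_zero_of_mem_dualCone_SEP hX h
  have hrow : ∀ i k l, X (i, 0) (k, l) = 0 := fun i k l => by
    rw [← hX.1.apply, hcol, star_zero]
  refine posSemidef_iff_expectation_nonneg.mpr ⟨hX.1, fun x => ?_⟩
  convert (mem_dualCone_SEP_iff.mp hX).2 (fun i => x (i, 1)) (Pi.single 1 1) using 1
  simp [expectation, dotProduct, mulVec, tensorVec, Fintype.sum_prod_type, hcol, hrow]

end ZeroDiagonal

section TwoQubits

open Matrix

/-- The real-linear map `z ↦ u z + v z̄` of the complex plane. -/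
noncomputable def mulAddMulConj (u v : ℂ) : ℂ →ₗ[ℝ] ℂ :=
  LinearMap.mulLeft ℝ u + LinearMap.mulLeft ℝ v ∘ₗ Complex.conjAe.toLinearMap

theorem mulAddMulConj_apply (u v z : ℂ) : mulAddMulConj u v z = u * z + v * star z := rfl

theorem adjoint_mulAddMulConj (u v : ℂ) :
    (mulAddMulConj u v).adjoint = mulAddMulConj (star u) v := by
  refine ((LinearMap.eq_adjoint_iff _ _).mpr fun z w => ?_).symm
  simp only [mulAddMulConj_apply, Complex.inner, Complex.star_def, map_add, map_mul,
    Complex.conj_conj, Complex.add_re, Complex.mul_re, Complex.mul_im, Complex.add_im,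
    Complex.conj_re, Complex.conj_im]
  ring

theorem exists_norm_mulAddMulConj_eq (u v : ℂ) :
    ∃ w, ‖w‖ = 1 ∧ ‖mulAddMulConj u v w‖ = ‖u‖ + ‖v‖ := by
  let θ : ℝ := (v.arg - u.arg) / 2
  let φ : ℝ := (v.arg + u.arg) / 2
  have hu : u * Complex.exp (θ * Complex.I) = ‖u‖ * Complex.exp (φ * Complex.I) := by
    nth_rw 1 [← Complex.norm_mul_exp_arg_mul_I u, mul_assoc, ← Complex.exp_add]
    congr 2
    push_cast [θ, φ]
    ring
  have hv : v * star (Complex.exp (θ * Complex.I)) = ‖v‖ * Complex.exp (φ * Complex.I) := by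
    rw [Complex.star_def, ← Complex.exp_conj, map_mul, Complex.conj_ofReal, Complex.conj_I]
    nth_rw 1 [← Complex.norm_mul_exp_arg_mul_I v, mul_assoc, ← Complex.exp_add]
    congr 2
    push_cast [θ, φ]
    ring
  refine ⟨Complex.exp (θ * Complex.I), Complex.norm_exp_ofReal_mul_I θ, ?_⟩
  rw [mulAddMulConj_apply, hu, hv, ← add_mul, norm_mul, Complex.norm_exp_ofReal_mul_I, mul_one,
    ← Complex.ofReal_add, Complex.norm_real, Real.norm_of_nonneg (by positivity)]

theorem posSemidef_fin_two {a b : ℝ} {z : ℂ} (ha : 0 ≤ a) (hb : 0 ≤ b) (hz : ‖z‖ ^ 2 ≤ a * b) :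
    (!![(a : ℂ), z; star z, b]).PosSemidef := by
  refine posSemidef_iff_expectation_nonneg.mpr ⟨?_, fun x => ?_⟩
  · ext i j
    fin_cases i <;> fin_cases j <;> simp
  have hform : expectation !![(a : ℂ), z; star z, b] x =
      a * ‖x 0‖ ^ 2 + b * ‖x 1‖ ^ 2 + 2 * (star (x 0) * z * x 1).re := by
    simp only [expectation, dotProduct, mulVec, Fin.sum_univ_two, Complex.sq_norm,
      Complex.normSq_apply, Pi.star_apply, Complex.star_def, of_apply, cons_val', cons_val_zero,
      cons_val_one, cons_val_fin_one, Complex.add_re, Complex.add_im, Complex.mul_re,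
      Complex.mul_im, Complex.conj_re, Complex.conj_im, Complex.ofReal_re, Complex.ofReal_im]
    ring
  have hcross : -(‖x 0‖ * (√a * √b) * ‖x 1‖) ≤ (star (x 0) * z * x 1).re := by
    refine (neg_le_neg ?_).trans (Complex.abs_re_le_norm _ |> abs_le.mp).1
    rw [norm_mul, norm_mul, norm_star, ← Real.sqrt_mul ha]
    gcongr
    exact Real.le_sqrt_of_sq_le hz
  rw [hform]
  nlinarith [sq_nonneg (√a * ‖x 0‖ - √b * ‖x 1‖), Real.sq_sqrt ha, Real.sq_sqrt hb]

/-- An operator on two qubits has the shape of the letter X if its entries off the diagonal and the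
antidiagonal vanish. -/
structure IsXShaped (W : Matrix (Fin 2 × Fin 2) (Fin 2 × Fin 2) ℂ) : Prop where
  left : ∀ i j l, j ≠ l → W (i, j) (i, l) = 0
  right : ∀ i k j, i ≠ k → W (i, j) (k, j) = 0

variable {W : Matrix (Fin 2 × Fin 2) (Fin 2 × Fin 2) ℂ}

-- The determinant of the positive semidefinite matrix `leftSlice W ![z, 1]` is nonnegative.
theorem norm_mulAddMulConj_add_sq_le (hW : W ∈ dualCone (SEP (Fin 2) (Fin 2)))
    (h₀ : W (0, 0) (0, 0) = 0) (z : ℂ) :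
    ‖mulAddMulConj (W (1, 0) (0, 1)) (W (0, 0) (1, 1)) z + W (1, 0) (1, 1)‖ ^ 2 ≤
      (W (1, 0) (1, 0)).re * (W (0, 1) (0, 1)).re * ‖z‖ ^ 2 +
        2 * inner ℝ ((W (1, 0) (1, 0)).re • W (0, 1) (1, 1)) z +
          (W (1, 0) (1, 0)).re * (W (1, 1) (1, 1)).re := by
  have h01 := apply_right_eq_zero_of_mem_dualCone_SEP hW h₀ 1
  have h01' : W (0, 0) (0, 1) = 0 := by rw [← hW.1.apply, h01, star_zero]
  have h10 := apply_left_eq_zero_of_mem_dualCone_SEP hW h₀ 1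
  have h10' : W (0, 0) (1, 0) = 0 := by rw [← hW.1.apply, h10, star_zero]
  have h := norm_apply_sq_le_of_posSemidef (leftSlice_posSemidef hW ![z, 1]) 0 1
  simp only [leftSlice, of_apply, Fin.sum_univ_two, cons_val_zero, cons_val_one, star_one, h₀, h01',
    h10, h10', mul_zero, zero_mul, mul_one, one_mul, zero_add, add_zero] at h
  rw [← hW.1.apply (1, 1) (0, 1)] at h
  convert h using 2
  · congr 1
    rw [mulAddMulConj_apply]
    ring
  · simp only [Complex.inner, Complex.real_smul, Complex.sq_norm, Complex.normSq_apply,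
      Complex.star_def, map_mul, Complex.conj_ofReal, Complex.add_re, Complex.mul_re,
      Complex.mul_im, Complex.conj_re, Complex.conj_im, Complex.ofReal_re, Complex.ofReal_im]
    ring

theorem isXShaped_of_isHermitian (hW : W.IsHermitian)
    (hleft : ∀ i, W (i, 0) (i, 1) = 0) (hright : ∀ j, W (0, j) (1, j) = 0) : IsXShaped W := by
  refine ⟨fun i j l hjl => ?_, fun i k j hik => ?_⟩
  · fin_cases j <;> fin_cases l
    · exact absurd rfl hjl
    · exact hleft i
    · exact (hW.apply _ _).symm.trans ((congrArg star (hleft i)).trans (star_zero ℂ))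
    · exact absurd rfl hjl
  · fin_cases i <;> fin_cases k
    · exact absurd rfl hik
    · exact hright j
    · exact (hW.apply _ _).symm.trans ((congrArg star (hright j)).trans (star_zero ℂ))
    · exact absurd rfl hik

-- The two equations say that the shears by `z` and `β` clear the entries `(10, 11)` and `(01, 11)`.
theorem exists_mulAddMulConj_eq_zero (hW : W ∈ dualCone (SEP (Fin 2) (Fin 2)))
    (h₀ : W (0, 0) (0, 0) = 0) (hq : W (1, 0) (1, 0) ≠ 0) :
    ∃ z β, W (1, 0) (1, 0) * β +
        (mulAddMulConj (W (1, 0) (0, 1)) (W (0, 0) (1, 1)) z + W (1, 0) (1, 1)) = 0 ∧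
      W (0, 1) (0, 1) * z +
        (mulAddMulConj (W (0, 1) (1, 0)) (W (0, 0) (1, 1)) β + W (0, 1) (1, 1)) = 0 := by
  obtain ⟨z, hz⟩ := exists_adjoint_map_add_eq_of_forall_norm_map_add_sq_le _
    (norm_mulAddMulConj_add_sq_le hW h₀)
  set G := mulAddMulConj (W (1, 0) (0, 1)) (W (0, 0) (1, 1)) z + W (1, 0) (1, 1)
  rw [adjoint_mulAddMulConj, hW.1.apply, mulAddMulConj_apply, Complex.real_smul, Complex.real_smul,
    Complex.ofReal_mul] at hz
  rw [show ((W (1, 0) (1, 0)).re : ℂ) = W (1, 0) (1, 0) from hW.1.coe_re_apply_self _,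
    show ((W (0, 1) (0, 1)).re : ℂ) = W (0, 1) (0, 1) from hW.1.coe_re_apply_self _] at hz
  obtain ⟨β, hβ⟩ : ∃ β, W (1, 0) (1, 0) * β = -G := ⟨_, mul_div_cancel₀ _ hq⟩
  have hβ' : W (1, 0) (1, 0) * star β = -star G := by rw [← star_neg, ← hβ, star_mul', hW.1.apply]
  refine ⟨z, β, by rw [hβ, neg_add_cancel], mul_left_cancel₀ hq ?_⟩
  rw [mulAddMulConj_apply]
  linear_combination W (0, 1) (1, 0) * hβ + W (0, 0) (1, 1) * hβ' - hz

theorem exists_isUnit_isXShaped_conjTranspose_mul_mul (hW : W ∈ dualCone (SEP (Fin 2) (Fin 2)))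
    (h₀ : W (0, 0) (0, 0) = 0) (hq : W (1, 0) (1, 0) ≠ 0) :
    ∃ A B : Matrix (Fin 2) (Fin 2) ℂ, IsUnit A ∧ IsUnit B ∧
      ((A ⊗ₖ B)ᴴ * W * (A ⊗ₖ B)) (0, 0) (0, 0) = 0 ∧ IsXShaped ((A ⊗ₖ B)ᴴ * W * (A ⊗ₖ B)) := by
  obtain ⟨z, β, hβ, hz⟩ := exists_mulAddMulConj_eq_zero hW h₀ hq
  have h01 := apply_right_eq_zero_of_mem_dualCone_SEP hW h₀ 1
  have h01' : W (0, 0) (0, 1) = 0 := by rw [← hW.1.apply, h01, star_zero]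
  have h10 := apply_left_eq_zero_of_mem_dualCone_SEP hW h₀ 1
  have h10' : W (0, 0) (1, 0) = 0 := by rw [← hW.1.apply, h10, star_zero]
  refine ⟨!![1, z; 0, 1], !![1, β; 0, 1], by simp [isUnit_iff_isUnit_det],
    by simp [isUnit_iff_isUnit_det], by simp [mul_apply, Fintype.sum_prod_type, h₀],
    isXShaped_of_isHermitian (isHermitian_conjTranspose_mul_mul _ hW.1) (fun i => ?_) fun j => ?_⟩
  · fin_cases i
    · simp [mul_apply, Fintype.sum_prod_type, h₀, h01']
    · refine Eq.trans ?_ hβ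
      rw [mulAddMulConj_apply]
      simp only [mul_apply, Fintype.sum_prod_type, Fin.sum_univ_two, conjTranspose_apply,
        kroneckerMap_apply, of_apply, cons_val', cons_val_zero, cons_val_one, cons_val_fin_one,
        Fin.mk_one, star_one, star_zero, h₀, h01', h10, h10', mul_one, one_mul, mul_zero, zero_mul,
        zero_add, add_zero]
      ring
  · fin_cases j
    · simp [mul_apply, Fintype.sum_prod_type, h₀, h10']
    · refine Eq.trans ?_ hz
      rw [mulAddMulConj_apply]
      simp only [mul_apply, Fintype.sum_prod_type, Fin.sum_univ_two, conjTranspose_apply,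
        kroneckerMap_apply, of_apply, cons_val', cons_val_zero, cons_val_one, cons_val_fin_one,
        Fin.mk_one, star_mul', star_one, star_zero, h₀, h01, h01', h10', mul_one, one_mul, mul_zero,
        zero_mul, zero_add, add_zero]
      ring

theorem exists_le_mul_and_le_one_sub_mul {a b k : ℝ} (ha : 0 ≤ a) (hb : 0 ≤ b) (h : a + b ≤ k) :
    ∃ s : ℝ, 0 ≤ s ∧ s ≤ 1 ∧ a ≤ s * k ∧ b ≤ (1 - s) * k := by
  rcases (add_nonneg ha hb |>.trans h).eq_or_lt with rfl | hk
  · exact ⟨0, le_rfl, zero_le_one, by linarith, by linarith⟩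
  · refine ⟨a / k, by positivity, (div_le_one hk).mpr (by linarith), ?_, ?_⟩
    · rw [div_mul_cancel₀ _ hk.ne']
    · rw [sub_mul, div_mul_cancel₀ _ hk.ne']
      linarith

theorem norm_add_norm_le_of_mem_dualCone_SEP (hW : W ∈ dualCone (SEP (Fin 2) (Fin 2)))
    (h₀ : W (0, 0) (0, 0) = 0) :
    ‖W (0, 1) (1, 0)‖ + ‖W (0, 0) (1, 1)‖ ≤ √((W (0, 1) (0, 1)).re * (W (1, 0) (1, 0)).re) := by
  obtain ⟨w, hw, hnorm⟩ := exists_norm_mulAddMulConj_eq (W (1, 0) (0, 1)) (W (0, 0) (1, 1))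
  have h := norm_map_sq_le_of_forall_norm_map_add_sq_le _ (norm_mulAddMulConj_add_sq_le hW h₀) w
  rw [hw, hnorm, one_pow, mul_one, mul_comm (W (1, 0) (1, 0)).re, ← hW.1.apply, norm_star] at h
  exact Real.le_sqrt_of_sq_le h

/-- The isometry embedding a qubit into two qubits as the span of `|01⟩` and `|10⟩`. -/
def antidiagonalEmbedding : Matrix (Fin 2 × Fin 2) (Fin 2) ℂ :=
  of fun p i => if p = (i, i.rev) then 1 else 0

theorem posSemidef_antidiagonalEmbedding_mul_mul {a b : ℝ} {z : ℂ} {s : ℝ} (ha : 0 ≤ a)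
    (hb : 0 ≤ b) (hs : 0 ≤ s) (hz : ‖z‖ ≤ s * √(a * b)) :
    (antidiagonalEmbedding * !![((s * a : ℝ) : ℂ), z; star z, ((s * b : ℝ) : ℂ)] *
      antidiagonalEmbeddingᴴ).PosSemidef := by
  refine (posSemidef_fin_two (by positivity) (by positivity) ?_).mul_mul_conjTranspose_same _
  calc ‖z‖ ^ 2 ≤ (s * √(a * b)) ^ 2 := by gcongr
    _ = s * a * (s * b) := by rw [mul_pow, Real.sq_sqrt (by positivity)]; ring

theorem IsXShaped.eq_add_partialTranspose (hX : IsXShaped W) (hW : W.IsHermitian)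
    (h₀ : W (0, 0) (0, 0) = 0) (s : ℝ) :
    W = antidiagonalEmbedding *
          !![((s * (W (0, 1) (0, 1)).re : ℝ) : ℂ), W (0, 1) (1, 0);
            star (W (0, 1) (1, 0)), ((s * (W (1, 0) (1, 0)).re : ℝ) : ℂ)] *
          antidiagonalEmbeddingᴴ + single (1, 1) (1, 1) (W (1, 1) (1, 1)) +
        partialTranspose (antidiagonalEmbedding *
          !![(((1 - s) * (W (0, 1) (0, 1)).re : ℝ) : ℂ), W (0, 0) (1, 1);
            star (W (0, 0) (1, 1)), (((1 - s) * (W (1, 0) (1, 0)).re : ℝ) : ℂ)] *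
          antidiagonalEmbeddingᴴ) := by
  have hp : ((W (0, 1) (0, 1)).re : ℂ) = W (0, 1) (0, 1) := hW.coe_re_apply_self _
  have hq : ((W (1, 0) (1, 0)).re : ℂ) = W (1, 0) (1, 0) := hW.coe_re_apply_self _
  rw [hW.apply, hW.apply]
  push_cast
  rw [hp, hq]
  ext ⟨i, j⟩ ⟨k, l⟩
  fin_cases i <;> fin_cases j <;> fin_cases k <;> fin_cases l <;>
    simp [antidiagonalEmbedding, partialTranspose_apply, mul_apply, h₀,
      hX.left, hX.right, Fin.sum_univ_two, Fin.rev] <;> ring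

theorem IsXShaped.isDecomposable (hX : IsXShaped W) (hW : W ∈ dualCone (SEP (Fin 2) (Fin 2)))
    (h₀ : W (0, 0) (0, 0) = 0) : IsDecomposable W := by
  obtain ⟨s, hs₀, hs₁, he, hc⟩ := exists_le_mul_and_le_one_sub_mul (norm_nonneg _) (norm_nonneg _)
    (norm_add_norm_le_of_mem_dualCone_SEP hW h₀)
  have hdiag : ∀ p, 0 ≤ (W p p).re := fun p =>
    (Complex.nonneg_iff.mp (apply_self_nonneg_of_mem_dualCone_SEP hW p)).1
  have h₁₁ : (single (1 : Fin 2 × Fin 2) 1 (W (1, 1) (1, 1))).PosSemidef := by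
    rw [← diagonal_single]
    exact .diagonal (Pi.single_nonneg.mpr (apply_self_nonneg_of_mem_dualCone_SEP hW _))
  exact ⟨_, _, (posSemidef_antidiagonalEmbedding_mul_mul (hdiag _) (hdiag _) hs₀ he).add h₁₁,
    posSemidef_antidiagonalEmbedding_mul_mul (hdiag _) (hdiag _) (sub_nonneg.mpr hs₁) hc,
    hX.eq_add_partialTranspose hW.1 h₀ s⟩

theorem isDecomposable_of_mem_dualCone_SEP_of_apply_eq_zero
    (hW : W ∈ dualCone (SEP (Fin 2) (Fin 2))) (h₀ : W (0, 0) (0, 0) = 0) : IsDecomposable W := by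
  by_cases hq : W (1, 0) (1, 0) = 0
  · exact isDecomposable_of_posSemidef
      (posSemidef_of_apply_eq_zero hW (Fin.forall_fin_two.mpr ⟨h₀, hq⟩))
  · obtain ⟨A, B, hA, hB, h₀', hX⟩ := exists_isUnit_isXShaped_conjTranspose_mul_mul hW h₀ hq
    exact isDecomposable_of_conjTranspose_mul_mul_kronecker hA hB
      (hX.isDecomposable (conjTranspose_mul_mul_kronecker_mem_dualCone_SEP hW A B) h₀')

-- The Størmer–Woronowicz theorem, stated for Choi matrices.
theorem isDecomposable_of_mem_dualCone_SEP (hW : W ∈ dualCone (SEP (Fin 2) (Fin 2))) :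
    IsDecomposable W := by
  obtain ⟨μ, hμ, hW', a, b, ha, hb, hab⟩ := exists_sub_smul_one_mem_dualCone_SEP hW
  have he : (Pi.single 0 1 : Fin 2 → ℂ) ≠ 0 := Pi.single_ne_zero_iff.mpr one_ne_zero
  obtain ⟨A, hA, hAa⟩ := exists_isUnit_mulVec_eq he ha
  obtain ⟨B, hB, hBb⟩ := exists_isUnit_mulVec_eq he hb
  have hAB := conjTranspose_mul_mul_kronecker_mem_dualCone_SEP hW' A B
  have h₀ : ((A ⊗ₖ B)ᴴ * (W - μ • 1) * (A ⊗ₖ B)) (0, 0) (0, 0) = 0 := by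
    have h : (((A ⊗ₖ B)ᴴ * (W - μ • 1) * (A ⊗ₖ B)) (0, 0) (0, 0)).re = 0 := by
      rw [← expectation_single, expectation_conjTranspose_mul_mul, ← tensorVec_single,
        kronecker_mulVec_tensorVec, hAa, hBb, hab]
    exact (hAB.1.coe_re_apply_self _).symm.trans (congrArg _ h)
  have hdec := isDecomposable_of_conjTranspose_mul_mul_kronecker hA hB
    (isDecomposable_of_mem_dualCone_SEP_of_apply_eq_zero hAB h₀)
  simpa only [sub_add_cancel] using hdec.add_posSemidef (PosSemidef.one.smul hμ)

end TwoQubits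

section PureEntanglementWitness

open Matrix

open scoped MatrixOrder Matrix.Norms.L2Operator in
theorem exists_mem_unitaryGroup_posDef_mul {n : Type*} [Fintype n] [DecidableEq n]
    {M : Matrix n n ℂ} (hM : IsUnit M) : ∃ U ∈ unitaryGroup n ℂ, (M * U).PosDef := by
  obtain ⟨H, hH, hHM⟩ : ∃ H : Matrix n n ℂ, H.PosSemidef ∧ H * H = M * Mᴴ :=
    ⟨CFC.sqrt (M * Mᴴ), (CFC.sqrt_nonneg _).posSemidef,
      CFC.sqrt_mul_sqrt_self _ (posSemidef_self_mul_conjTranspose M).nonneg⟩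
  have hdet : IsUnit M.det := (isUnit_iff_isUnit_det M).mp hM
  have hunit : IsUnit H :=
    isUnit_of_mul_isUnit_left (hHM ▸ hM.mul hM.star)
  refine ⟨M⁻¹ * H, mem_unitaryGroup_iff.mpr ?_, ?_⟩
  · rw [star_eq_conjTranspose, conjTranspose_mul, hH.1.eq, Matrix.mul_assoc, ← Matrix.mul_assoc H,
      hHM, Matrix.mul_assoc, ← conjTranspose_mul, nonsing_inv_mul _ hdet, conjTranspose_one,
      Matrix.mul_one, nonsing_inv_mul _ hdet]
  · rw [mul_nonsing_inv_cancel_left _ _ hdet]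
    exact hH.posDef_iff_isUnit.mpr hunit

theorem partialTranspose_vecMulVec_vec_mulVec_vec {m n : Type*} [Fintype m] [Fintype n]
    (M Φ : Matrix n m ℂ) :
    partialTranspose (vecMulVec (vec M) (star (vec M))) *ᵥ vec Φ =
      vec (M.map star * Φᵀ * M) := by
  ext p
  simp only [mulVec, dotProduct, partialTranspose_apply, vecMulVec_apply, Pi.star_apply, vec,
    Fintype.sum_prod_type, mul_apply, map_apply, transpose_apply, Finset.sum_mul]
  rw [Finset.sum_comm]
  exact Finset.sum_congr rfl fun _ _ => Finset.sum_congr rfl fun _ _ => by ring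

theorem expectation_partialTranspose_vecMulVec_vec {m n : Type*} [Fintype m] [Fintype n]
    (M Φ : Matrix n m ℂ) :
    expectation (partialTranspose (vecMulVec (vec M) (star (vec M)))) (vec Φ) =
      (M * Φᴴ * (M * Φᴴ).map star).trace.re := by
  have hmap : (M * Φᴴ).map star = M.map star * Φᵀ := by
    ext i j
    simp only [map_apply, mul_apply, conjTranspose_apply, transpose_apply, star_sum, star_mul',
      star_star]
  rw [expectation, partialTranspose_vecMulVec_vec_mulVec_vec, star_vec_dotProduct_vec,
    ← Matrix.mul_assoc, trace_mul_comm, hmap, Matrix.mul_assoc]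

theorem neg_two_mul_norm_det_le_re_trace_mul_map_star (Y : Matrix (Fin 2) (Fin 2) ℂ) :
    -(2 * ‖Y.det‖) ≤ (Y * Y.map star).trace.re := by
  have htr : (Y * Y.map star).trace.re =
      ‖Y 0 0‖ ^ 2 + ‖Y 1 1‖ ^ 2 + 2 * (Y 0 1 * star (Y 1 0)).re := by
    simp only [trace_fin_two, mul_apply, Fin.sum_univ_two, map_apply, Complex.star_def,
      Complex.add_re, Complex.mul_re, Complex.conj_re, Complex.conj_im, Complex.sq_norm,
      Complex.normSq_apply]
    ring
  have hcross : -(‖Y 0 1‖ * ‖Y 1 0‖) ≤ (Y 0 1 * star (Y 1 0)).re := by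
    rw [← norm_star (Y 1 0), ← norm_mul]
    exact (abs_le.mp (Complex.abs_re_le_norm _)).1
  have hdet : ‖Y 0 1‖ * ‖Y 1 0‖ ≤ ‖Y 0 0‖ * ‖Y 1 1‖ + ‖Y.det‖ := by
    rw [← norm_mul, ← norm_mul, det_fin_two]
    simpa using norm_sub_le (Y 0 0 * Y 1 1) (Y 0 0 * Y 1 1 - Y 0 1 * Y 1 0)
  linarith [two_mul_le_add_sq ‖Y 0 0‖ ‖Y 1 1‖]

theorem posSemidef_partialTranspose_of_det_eq_zero {M : Matrix (Fin 2) (Fin 2) ℂ}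
    (hM : M.det = 0) : (partialTranspose (vecMulVec (vec M) (star (vec M)))).PosSemidef := by
  refine posSemidef_iff_expectation_nonneg.mpr
    ⟨isHermitian_partialTranspose (posSemidef_vecMulVec_self_star _).1, fun x => ?_⟩
  obtain ⟨Φ, rfl⟩ := vec_bijective.surjective x
  have h := neg_two_mul_norm_det_le_re_trace_mul_map_star (M * Φᴴ)
  rwa [det_mul, hM, zero_mul, norm_zero, mul_zero, neg_zero,
    ← expectation_partialTranspose_vecMulVec_vec] at h

theorem IsPureState.exists_eq_smul_partialTranspose
    {ρ : Matrix (Fin 2 × Fin 2) (Fin 2 × Fin 2) ℂ}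
    (hρ : IsPureState (dualCone (SEP (Fin 2) (Fin 2))) ρ) (hpsd : ¬ ρ.PosSemidef) :
    ∃ (c : ℝ) (M : Matrix (Fin 2) (Fin 2) ℂ), 0 ≤ c ∧
      ρ = c • partialTranspose (vecMulVec (vec M) (star (vec M))) := by
  obtain ⟨P, Q, hP, hQ, hPQ⟩ := isDecomposable_of_mem_dualCone_SEP hρ.1.1
  obtain ⟨k, φ, rfl⟩ := posSemidef_iff_eq_sum_vecMulVec.mp hP
  obtain ⟨l, ψ, rfl⟩ := posSemidef_iff_eq_sum_vecMulVec.mp hQ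
  have hone : 1 ∈ SEP (Fin 2) (Fin 2) := by
    rw [← one_kronecker_one]
    exact kronecker_mem_SEP .one .one
  have hφ : ∀ i, (vecMulVec (φ i) (star (φ i))).PosSemidef := fun i =>
    posSemidef_vecMulVec_self_star _
  have hψ : ∀ j, (vecMulVec (ψ j) (star (ψ j))).PosSemidef := fun j =>
    posSemidef_vecMulVec_self_star _
  obtain ⟨i | j, c, hc, h⟩ := hρ.exists_eq_smul_of_eq_sum hone
    (X := Sum.elim (fun i => vecMulVec (φ i) (star (φ i)))
      fun j => partialTranspose (vecMulVec (ψ j) (star (ψ j))))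
    (Sum.rec (fun i => posSemidef_mem_dualCone_SEP (hφ i))
      fun j => partialTranspose_mem_dualCone_SEP (hψ j))
    (by rw [hPQ, partialTranspose_sum, Fintype.sum_sum_type]; rfl)
  · exact absurd (h ▸ (hφ i).smul hc) hpsd
  · obtain ⟨M, hM⟩ := vec_bijective.surjective (ψ j)
    exact ⟨c, M, hc, hM ▸ h⟩

end PureEntanglementWitness

section PauliCorrelation

open Matrix

/-- The antisymmetric matrix whose vectorization `|01⟩ - |10⟩` is the unnormalized singlet. -/
def singletMatrix : Matrix (Fin 2) (Fin 2) ℂ := !![0, -1; 1, 0]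

theorem sum_pauli_kronecker_pauli :
    ∑ c, pauli c ⊗ₖ pauli c =
      1 - (2 : ℝ) • vecMulVec (vec singletMatrix) (star (vec singletMatrix)) := by
  ext ⟨i, j⟩ ⟨k, l⟩
  fin_cases i <;> fin_cases j <;> fin_cases k <;> fin_cases l <;>
    simp [Fin.sum_univ_three, Matrix.sum_apply, pauli, singletMatrix, flip, vecMulVec_apply] <;>
    norm_num

theorem APauli_eq_trace_sub_expectation (ρ : Matrix (Fin 2 × Fin 2) (Fin 2 × Fin 2) ℂ)
    {U V : Matrix (Fin 2) (Fin 2) ℂ} (hU : U ∈ unitaryGroup (Fin 2) ℂ)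
    (hV : V ∈ unitaryGroup (Fin 2) ℂ) :
    APauli ρ U V = ρ.trace.re - 2 * expectation ρ ((U ⊗ₖ V)ᴴ *ᵥ vec singletMatrix) := by
  have htr : ((U ⊗ₖ V) * ρ * (U ⊗ₖ V)ᴴ).trace = ρ.trace := by
    rw [trace_mul_comm, ← Matrix.mul_assoc, ← star_eq_conjTranspose,
      mem_unitaryGroup_iff'.mp (kronecker_mem_unitary hU hV), Matrix.one_mul]
  rw [APauli, ← trace_sum, ← Finset.mul_sum, sum_pauli_kronecker_pauli, ← conjTranspose_kronecker,
    Matrix.mul_sub, Matrix.mul_one, trace_sub, htr, Complex.sub_re, Matrix.mul_smul, trace_smul,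
    Complex.smul_re, re_trace_mul_vecMulVec_star, ← expectation_conjTranspose_mul_mul,
    conjTranspose_conjTranspose, smul_eq_mul]

theorem APauli_le_trace {ρ : Matrix (Fin 2 × Fin 2) (Fin 2 × Fin 2) ℂ} (hρ : ρ.PosSemidef)
    {U V : Matrix (Fin 2) (Fin 2) ℂ} (hU : U ∈ unitaryGroup (Fin 2) ℂ)
    (hV : V ∈ unitaryGroup (Fin 2) ℂ) : APauli ρ U V ≤ ρ.trace.re := by
  rw [APauli_eq_trace_sub_expectation ρ hU hV]
  linarith [(posSemidef_iff_expectation_nonneg.mp hρ).2 ((U ⊗ₖ V)ᴴ *ᵥ vec singletMatrix)]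

theorem trace_mul_singletMatrix_mul_map_star {H : Matrix (Fin 2) (Fin 2) ℂ} (hH : H.IsHermitian) :
    (H * singletMatrixᴴ * (H * singletMatrixᴴ).map star).trace = -(2 * H.det) := by
  simp only [trace_fin_two, mul_apply, Fin.sum_univ_two, map_apply, conjTranspose_apply,
    singletMatrix, det_fin_two, of_apply, cons_val', cons_val_zero, cons_val_one, cons_val_fin_one,
    star_add, star_mul', star_neg, star_one, star_zero, hH.apply]
  ring

theorem exists_trace_lt_APauli {M : Matrix (Fin 2) (Fin 2) ℂ} (hM : M.det ≠ 0) {c : ℝ}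
    (hc : 0 < c) {ρ : Matrix (Fin 2 × Fin 2) (Fin 2 × Fin 2) ℂ}
    (hρ : ρ = c • partialTranspose (vecMulVec (vec M) (star (vec M)))) :
    ∃ U ∈ unitaryGroup (Fin 2) ℂ, ρ.trace.re < APauli ρ U 1 := by
  obtain ⟨U, hU, hH⟩ := exists_mem_unitaryGroup_posDef_mul
    ((isUnit_iff_isUnit_det M).mpr hM.isUnit)
  have hUT : Uᵀ ∈ unitaryGroup (Fin 2) ℂ := transpose_mem_unitaryGroup_iff.mpr hU
  have hvec : (Uᵀ ⊗ₖ 1)ᴴ *ᵥ vec singletMatrix = vec (singletMatrix * Uᴴ) := by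
    rw [conjTranspose_kronecker, conjTranspose_one, kronecker_mulVec_vec, Matrix.one_mul]
    rfl
  have hexp : expectation ρ ((Uᵀ ⊗ₖ 1)ᴴ *ᵥ vec singletMatrix) = c * -(2 * (M * U).det.re) := by
    rw [hvec, hρ, expectation_smul, expectation_partialTranspose_vecMulVec_vec, conjTranspose_mul,
      conjTranspose_conjTranspose, ← Matrix.mul_assoc, trace_mul_singletMatrix_mul_map_star hH.1]
    simp
  refine ⟨Uᵀ, hUT, ?_⟩
  rw [APauli_eq_trace_sub_expectation ρ hUT (one_mem _), hexp]
  linarith [mul_pos hc (Complex.pos_iff.mp hH.det_pos).1]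

end PauliCorrelation

theorem theorem3 :
    (∀ ρ₀ : Matrix (Fin 2 × Fin 2) (Fin 2 × Fin 2) ℂ,
      IsBeyondQuantum ρ₀ → IsPureState (dualCone (SEP (Fin 2) (Fin 2))) ρ₀ →
        ∃ UA ∈ Matrix.unitaryGroup (Fin 2) ℂ, ∃ UB ∈ Matrix.unitaryGroup (Fin 2) ℂ,
          1 < APauli ρ₀ UA UB) ∧
    (∀ ρ₁ ∈ stateSpace (SES (Fin 2) (Fin 2)),
      ∀ UA ∈ Matrix.unitaryGroup (Fin 2) ℂ, ∀ UB ∈ Matrix.unitaryGroup (Fin 2) ℂ,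
        APauli ρ₁ UA UB ≤ 1) := by
  have htr : ∀ ρ : Matrix (Fin 2 × Fin 2) (Fin 2 × Fin 2) ℂ, ρ.trace = 1 → ρ.trace.re = 1 :=
    fun ρ h => by rw [h, Complex.one_re]
  refine ⟨fun ρ hbq hpure => ?_, fun ρ hρ U hU V hV => ?_⟩
  · have hpsd : ¬ ρ.PosSemidef := fun h => hbq.2 ⟨h, hbq.1.2⟩
    obtain ⟨c, M, hc, hρ⟩ := hpure.exists_eq_smul_partialTranspose hpsd
    have hdet : M.det ≠ 0 := fun h =>
      hpsd (hρ ▸ (posSemidef_partialTranspose_of_det_eq_zero h).smul hc)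
    have hc' : 0 < c := hc.lt_of_ne' fun h => hpsd (by simpa [hρ, h] using Matrix.PosSemidef.zero)
    obtain ⟨U, hU, hlt⟩ := exists_trace_lt_APauli hdet hc' hρ
    exact ⟨U, hU, 1, one_mem _, (htr ρ hbq.1.2).symm.trans_lt hlt⟩
  · exact (APauli_le_trace hρ.1 hU hV).trans_eq (htr ρ hρ.2)
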